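/- For sets $A,B\subseteq\mathbb N$, write $B\le_{tt}A$ ($B$ is truth-table reducible to $A$) if there are total computable functions $f$ and $g$ such that, for every $m$, $f(m)$ is a natural number, $g(m)$ is a (code of a) truth table assigning to each binary string $\sigma$ of length $f(m)$ a value in $\{0,1\}$, and $m\in B$ if and only if the value assigned to the string $A(0)A(1)\cdots A(f(m)-1)$ is $1$. A computably enumerable (c.e.) set $A$ is Turing complete if every c.e. set is Turing reducible to $A$. Theorem. There exist Turing complete c.e. sets $A_1,A_2\subseteq\mathbb N$ whose tt-degrees form a minimal pair in the structure of all tt-degrees; that is, neither $A_1$ nor $A_2$ is computable, and every set $B\subseteq\mathbb N$ (c.e. or not) with $B\le_{tt}A_1$ and $B\le_{tt}A_2$ is computable. -/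

import Mathlib

namespace TTMinimalPair

open scoped Computability

/-- A set of natural numbers is computably enumerable. -/
def IsCE (A : Set ℕ) : Prop := REPred fun n => n ∈ A

/-- A set of natural numbers is computable. -/
def IsComputable (A : Set ℕ) : Prop := ComputablePred fun n => n ∈ A

open Classical in
/-- The characteristic function of `A`, as an everywhere defined partial function
(the form in which Mathlib takes oracles). -/
noncomputable def charFun (A : Set ℕ) : ℕ →. ℕ :=
  fun n => Part.some (if n ∈ A then 1 else 0)

/-- Turing reducibility of sets. -/
def TuringLE (B A : Set ℕ) : Prop := charFun B ≤ᵀ charFun A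

/-- `A` is a Turing complete c.e. set: it is c.e. and every c.e. set is Turing reducible to it. -/
def IsTuringCompleteCE (A : Set ℕ) : Prop :=
  IsCE A ∧ ∀ C : Set ℕ, IsCE C → TuringLE C A

open Classical in
/-- The binary string `A ↾ n` of length `n`, that is, `A(0) A(1) … A(n-1)`. -/
noncomputable def initSeg (A : Set ℕ) (n : ℕ) : List Bool :=
  (List.range n).map fun k => decide (k ∈ A)

/-- Truth-table reducibility `B ≤_tt A`. The reduction is given by two (total) computable functions:
`f m` bounds the use on input `m`, and `g m` codes the truth table on the rows `σ ∈ 2^(f m)`, by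
listing the rows on which the output is `1`; the output is `0` on all other rows of length `f m`. -/
def TTLE (B A : Set ℕ) : Prop :=
  ∃ (f : ℕ → ℕ) (g : ℕ → List (List Bool)), Computable f ∧ Computable g ∧
    ∀ m, m ∈ B ↔ initSeg A (f m) ∈ g m

/-- The tt-degrees of `A₁` and `A₂` form a minimal pair: both are nonzero (where the zero degree is
the degree of the computable sets), and zero is the only tt-degree below both of them. -/
def IsTTMinimalPair (A₁ A₂ : Set ℕ) : Prop :=
  ¬ IsComputable A₁ ∧ ¬ IsComputable A₂ ∧
    ∀ B : Set ℕ, TTLE B A₁ → TTLE B A₂ → IsComputable B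

end TTMinimalPair

/-!
Each `Aᵢ` is the complement of the range of a sequence of movable markers: marker `j` belongs to
`A₀` or `A₁` according to the parity of `j`. A stage of the construction chooses an index `c` and
moves all markers from the `c`-th on, far out, to later positions of the same parity class, so that
the old positions are enumerated.

*Coding.* When the `k`-th computation halts, a marker of index at most `k` is moved. As soon as the
marker `2k + i` sits outside `Aᵢ` it has come to rest, so `Aᵢ` computes the halting problem.

*Minimality.* Marker `c` is also moved if this makes the `e`-th pair of truth table reductions
disagree, for some `e ≤ c`, unless there is already such a disagreement with uses below marker `c`.
Since truth tables are total, the outcome of a move can be evaluated in advance. After the move the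
disagreement has its uses below marker `c` and persists, hence each marker moves finitely often. Let
`Aᵢ[c]` be `Aᵢ` together with the final positions of all markers from the `c`-th on. If the `e`-th
pair agrees on `A₀, A₁`, then for all `c ≥ e` it agrees on `A₀[c], A₁[c]`, for otherwise marker `c`
would be moved once more. But passing from `c` to `c + 1` changes only one of the two sets, hence
neither output. So the reductions give the same output on `A₀` as on the cofinite set `A₀[e]`.
-/

namespace TTMinimalPair

open Filter
open Nat.Partrec (Code)
open Nat.Partrec.Code Encodable Denumerable

section Primrec

open Primrec

variable {α β : Type*} [Primcodable α] [Primcodable β]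

lemma primrecPred_iff {p q : α → Prop} (hp : PrimrecPred p) (hq : PrimrecPred q) :
    PrimrecPred fun a => p a ↔ q a :=
  ((hp.and hq).or (hp.not.and hq.not)).of_eq fun _ => iff_iff_and_or_not_and_not.symm

lemma primrecPred_exists_mem_list {R : α → β → Prop} {l : α → List β} (hl : Primrec l)
    (hR : PrimrecRel R) : PrimrecPred fun a => ∃ x ∈ l a, R a x :=
  (PrimrecRel.swap hR).exists_mem_list.comp hl Primrec.id

lemma primrecPred_forall_mem_list {R : α → β → Prop} {l : α → List β} (hl : Primrec l)
    (hR : PrimrecRel R) : PrimrecPred fun a => ∀ x ∈ l a, R a x :=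
  (PrimrecRel.swap hR).forall_mem_list.comp hl Primrec.id

lemma primrecPred_exists_lt {R : α → ℕ → Prop} {n : α → ℕ} (hn : Primrec n)
    (hR : PrimrecRel R) : PrimrecPred fun a => ∃ x < n a, R a x :=
  (primrecPred_exists_mem_list (list_range.comp hn) hR).of_eq fun a => by
    simp only [List.mem_range]

lemma primrecPred_forall_lt {R : α → ℕ → Prop} {n : α → ℕ} (hn : Primrec n)
    (hR : PrimrecRel R) : PrimrecPred fun a => ∀ x < n a, R a x :=
  (primrecPred_forall_mem_list (list_range.comp hn) hR).of_eq fun a => by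
    simp only [List.mem_range]

lemma primrecPred_exists_mem_option {R : α → β → Prop} {o : α → Option β} (ho : Primrec o)
    (hR : PrimrecRel R) : PrimrecPred fun a => ∃ x ∈ o a, R a x :=
  (primrecPred_exists_mem_list (optionToList.comp ho) hR).of_eq fun a => by
    simp only [Option.mem_toList, Option.mem_def]

lemma primrecRel_mem_list : PrimrecRel fun (b : β) (l : List β) => b ∈ l :=
  (primrecPred_exists_mem_list (R := fun (p : β × List β) x => x = p.1) snd
    (Primrec.eq.comp snd (fst.comp fst))).of_eq fun _ => exists_eq_right

end Primrec

section Tables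

/-- A truth table: its use `u`, together with the list of those rows of length `u` on which the
output is `1`. -/
abbrev Table := ℕ × List (List Bool)

/-- The truth table `T` outputs `1` on the oracle `A`. -/
def Table.Accepts (T : Table) (A : Set ℕ) : Prop := initSeg A T.1 ∈ T.2

lemma initSeg_congr {A B : Set ℕ} {n : ℕ} (h : ∀ x < n, (x ∈ A ↔ x ∈ B)) :
    initSeg A n = initSeg B n :=
  List.map_congr_left fun x hx => decide_eq_decide.2 (h x (List.mem_range.1 hx))

lemma Table.accepts_congr {T : Table} {A B : Set ℕ} (h : ∀ x < T.1, (x ∈ A ↔ x ∈ B)) :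
    T.Accepts A ↔ T.Accepts B := by
  rw [Accepts, Accepts, initSeg_congr h]

lemma ttle_iff {A B : Set ℕ} :
    TTLE B A ↔ ∃ T : ℕ → Table, Computable T ∧ ∀ m, m ∈ B ↔ (T m).Accepts A :=
  ⟨fun ⟨f, g, hf, hg, h⟩ => ⟨fun m => (f m, g m), hf.pair hg, h⟩,
    fun ⟨T, hT, h⟩ => ⟨fun m => (T m).1, fun m => (T m).2, Computable.fst.comp hT,
      Computable.snd.comp hT, h⟩⟩

lemma primrecPred_accepts {α : Type*} [Primcodable α] {A : α → Set ℕ} {T : α → Table}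
    (hA : PrimrecRel fun a x => x ∈ A a) (hT : Primrec T) :
    PrimrecPred fun a => (T a).Accepts (A a) := by
  classical
  have hseg : Primrec fun a => initSeg (A a) (T a).1 :=
    Primrec.list_map (Primrec.list_range.comp (Primrec.fst.comp hT)) hA.decide
  exact primrecRel_mem_list.comp hseg (Primrec.snd.comp hT)

lemma IsComputable.computable_initSeg {A : Set ℕ} (hA : IsComputable A) :
    Computable (initSeg A) := by
  classical
  have hrec : Computable fun n : ℕ =>
      (n.rec [] fun k σ => σ ++ [decide (k ∈ A)] : List Bool) :=
    Computable.nat_rec Computable.id (Computable.const [])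
      (Computable.list_concat.comp (Computable.snd.comp Computable.snd)
        (hA.decide.comp (Computable.fst.comp Computable.snd))).to₂
  refine hrec.of_eq fun n => ?_
  induction n with
  | zero => rfl
  | succ n ih =>
    simp only [ih, initSeg, List.range_succ, List.map_append, List.map_singleton]

lemma TTLE.isComputable {A B : Set ℕ} (hBA : TTLE B A) (hA : IsComputable A) :
    IsComputable B := by
  classical
  obtain ⟨f, g, hf, hg, hB⟩ := hBA
  have hdec : Computable fun m => decide (initSeg A (f m) ∈ g m) :=
    primrecRel_mem_list.decide.to_comp.comp (hA.computable_initSeg.comp hf) hg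
  exact hdec.computablePred.of_eq fun m => (hB m).symm

end Tables

section Programs

/-- The value in `α` that the `e`-th program outputs on `m` within `s` steps, if any. -/
def output (α : Type*) [Encodable α] (e s m : ℕ) : Option α :=
  (evaln s (ofNat Code e) m).bind decode

/-- The `e`-th program computes the total function `F`. -/
def Computes {α : Type*} [Encodable α] (e : ℕ) (F : ℕ → α) : Prop :=
  ∀ m, encode (F m) ∈ eval (ofNat Code e) m

lemma output_mono {α : Type*} [Encodable α] {e s t m : ℕ} {a : α} (hst : s ≤ t)
    (h : a ∈ output α e s m) : a ∈ output α e t m := by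
  simp only [output, Option.mem_def, Option.bind_eq_some_iff] at h ⊢
  obtain ⟨n, hn, ha⟩ := h
  exact ⟨n, evaln_mono hst hn, ha⟩

lemma Computes.eventually_mem_output {α : Type*} [Encodable α] {e : ℕ} {F : ℕ → α}
    (hF : Computes e F) (m : ℕ) : ∀ᶠ s in atTop, F m ∈ output α e s m := by
  obtain ⟨s, hs⟩ := evaln_complete.1 (hF m)
  refine eventually_atTop.2 ⟨s, fun t hst => output_mono hst ?_⟩
  rw [output, Option.mem_def.1 hs, Option.bind_some, encodek, Option.mem_some]

lemma Computes.eq_of_mem_output {α : Type*} [Encodable α] {e s m : ℕ} {F : ℕ → α} {a : α}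
    (hF : Computes e F) (h : a ∈ output α e s m) : a = F m := by
  simp only [output, Option.mem_def, Option.bind_eq_some_iff] at h
  obtain ⟨n, hn, ha⟩ := h
  rw [← Part.mem_unique (hF m) (evaln_sound hn), encodek] at ha
  exact (Option.some.inj ha).symm

variable {α : Type*} [Primcodable α]

lemma exists_computes {F : ℕ → α} (hF : Computable F) : ∃ e, Computes e F := by
  obtain ⟨code, hcode⟩ := exists_code.1 (Partrec.nat_iff.1 (Computable.encode.comp hF).partrec)
  exact ⟨encode code, fun m => by simp [hcode]⟩

lemma primrec_output : Primrec fun p : (ℕ × ℕ) × ℕ => output α p.1.1 p.1.2 p.2 :=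
  Primrec.option_bind (primrec_evaln.comp (((Primrec.snd.comp Primrec.fst).pair
    ((Primrec.ofNat Code).comp (Primrec.fst.comp Primrec.fst))).pair Primrec.snd))
    (Primrec.decode.comp Primrec.snd)

end Programs

section TuringReductions

open Classical in
lemma isComputable_iff_partrec_charFun {A : Set ℕ} : IsComputable A ↔ Partrec (charFun A) := by
  refine ⟨fun h => (ComputablePred.ite (Computable.const 1) (Computable.const 0) h).partrec,
    fun h => ?_⟩
  have hA : Computable fun n => if n ∈ A then 1 else 0 := h
  exact (Primrec.eq.decide.to_comp.comp hA (Computable.const 1)).of_eq (fun n => by simp)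
    |>.computablePred

lemma TuringLE.isComputable {A B : Set ℕ} (hBA : TuringLE B A) (hA : IsComputable A) :
    IsComputable B := by
  rw [isComputable_iff_partrec_charFun] at hA ⊢
  exact RecursiveIn.partrec_of_oracle (by simpa using hA) hBA

lemma TuringLE.trans {A B C : Set ℕ} (hCB : TuringLE C B) (hBA : TuringLE B A) : TuringLE C A :=
  TuringReducible.trans hCB hBA

lemma turingLE_of_computable {B C : Set ℕ} {f : ℕ → ℕ} (hf : Computable f)
    (h : ∀ n, n ∈ C ↔ f n ∈ B) : TuringLE C B := by
  classical
  have hf' : Nat.RecursiveIn {charFun B} (f : ℕ →. ℕ) :=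
    (Partrec.nat_iff.1 hf.partrec).recursiveIn
  have hB : Nat.RecursiveIn {charFun B} (charFun B) := .oracle _ rfl
  exact RecursiveIn.iff_nat.2 ((hB.comp hf').of_eq fun n =>
    (Part.bind_some _ _).trans (congrArg Part.some (if_congr (h n).symm rfl rfl)))

lemma recursiveIn_find_notMem {A : Set ℕ} {q : ℕ → ℕ → ℕ} [DecidablePred (· ∈ A)]
    (hq : Computable₂ q) (hex : ∀ n, ∃ s, q n s ∉ A) :
    Nat.RecursiveIn {charFun A} fun n => Part.some (Nat.find (hex n)) := by
  have hq' : Nat.RecursiveIn {charFun A} fun p : ℕ => (q p.unpair.1 p.unpair.2 : Part ℕ) :=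
    (Partrec.nat_iff.1 (hq.comp (Computable.fst.comp Computable.unpair)
      (Computable.snd.comp Computable.unpair)).partrec).recursiveIn
  have hA : Nat.RecursiveIn {charFun A} (charFun A) := .oracle _ rfl
  have hqA : Nat.RecursiveIn {charFun A} fun p : ℕ => charFun A (q p.unpair.1 p.unpair.2) :=
    (hA.comp hq').of_eq fun p => Part.bind_some _ _
  refine hqA.rfind.of_eq fun n => Part.eq_some_iff.2 (Nat.mem_rfind.2 ⟨?_, fun hm => ?_⟩)
  · simp [charFun, Nat.find_spec (hex n)]
  · simp [charFun, not_not.1 (Nat.find_min (hex n) hm)]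

lemma turingLE_of_search {A C : Set ℕ} {q : ℕ → ℕ → ℕ} {D : ℕ → ℕ → Prop} (hq : Computable₂ q)
    (hD : ComputablePred fun p : ℕ × ℕ => D p.1 p.2) (hex : ∀ n, ∃ s, q n s ∉ A)
    (h : ∀ n s, q n s ∉ A → (n ∈ C ↔ D n s)) : TuringLE C A := by
  classical
  let E : Set ℕ := {p | D p.unpair.1 p.unpair.2}
  have hE : Nat.RecursiveIn {charFun A} (charFun E) :=
    (Partrec.nat_iff.1 (isComputable_iff_partrec_charFun.1
      (hD.decide.comp Computable.unpair).computablePred)).recursiveIn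
  have hpair : Nat.RecursiveIn {charFun A} fun n => Part.some (Nat.pair n (Nat.find (hex n))) :=
    (Nat.RecursiveIn.pair (Partrec.nat_iff.1 Partrec.some).recursiveIn
      (recursiveIn_find_notMem hq hex)).of_eq fun n => by simp [Seq.seq]
  refine RecursiveIn.iff_nat.2 ((hE.comp hpair).of_eq fun n => (Part.bind_some _ _).trans ?_)
  simp [charFun, E, h n _ (Nat.find_spec (hex n))]

end TuringReductions

section Halting

/-- The halting problem, for pairs of a program and an input. -/
def haltingSet : Set ℕ := {k | (eval (ofNat Code k.unpair.1) k.unpair.2).Dom}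

/-- The `k`-th computation halts within `s` steps. -/
def HaltsBy (s k : ℕ) : Prop := (evaln s (ofNat Code k.unpair.1) k.unpair.2).isSome = true

lemma haltsBy_mono : Monotone HaltsBy := by
  intro s t hst k h
  obtain ⟨a, ha⟩ := Option.isSome_iff_exists.1 h
  exact Option.isSome_iff_exists.2 ⟨a, evaln_mono hst ha⟩

lemma mem_haltingSet_iff {k : ℕ} : k ∈ haltingSet ↔ ∃ s, HaltsBy s k := by
  simp only [haltingSet, HaltsBy, Set.mem_ofPred_eq, Option.isSome_iff_exists, Part.dom_iff_mem,
    evaln_complete]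
  exact exists_comm

lemma primrecRel_haltsBy : PrimrecRel HaltsBy :=
  Primrec.eq.comp (Primrec.option_isSome.comp (primrec_evaln.comp ((Primrec.fst.pair
    ((Primrec.ofNat Code).comp (Primrec.fst.comp (Primrec.unpair.comp Primrec.snd)))).pair
    (Primrec.snd.comp (Primrec.unpair.comp Primrec.snd))))) (Primrec.const true)

lemma isCE_of_primrecRel {R : ℕ → ℕ → Prop} (hR : PrimrecRel R) : IsCE {x | ∃ s, R x s} := by
  classical
  have hsearch : Partrec fun x => Nat.rfind fun s => Part.some (decide (R x s)) :=
    Partrec.rfind hR.decide.to_comp.partrec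
  exact hsearch.dom_re.of_eq fun x => Nat.rfind_dom.trans (by simp)

lemma isCE_haltingSet : IsCE haltingSet :=
  (eval_part.comp ((Computable.ofNat Code).comp (Computable.fst.comp Computable.unpair))
    (Computable.snd.comp Computable.unpair)).dom_re

lemma not_isComputable_haltingSet : ¬ IsComputable haltingSet := by
  classical
  intro h
  have hpair : Computable fun c : Code => Nat.pair (encode c) 0 :=
    Primrec₂.natPair.to_comp.comp Computable.encode (Computable.const 0)
  refine ComputablePred.halting_problem 0
    ((h.decide.comp hpair).computablePred.of_eq fun c => ?_)
  simp [haltingSet]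

lemma IsCE.turingLE_haltingSet {C : Set ℕ} (hC : IsCE C) : TuringLE C haltingSet := by
  obtain ⟨c, hc⟩ := exists_code.1 (Partrec.nat_iff.1 (Partrec.map hC (Computable.const 0).to₂))
  have hpair : Computable fun n => Nat.pair (encode c) n :=
    (Primrec₂.natPair.comp (Primrec.const _) Primrec.id).to_comp
  refine turingLE_of_computable hpair fun n => ?_
  simp [haltingSet, hc, Part.dom_iff_mem]

lemma isTuringCompleteCE_of_haltingSet_turingLE {A : Set ℕ} (hA : IsCE A)
    (hK : TuringLE haltingSet A) : IsTuringCompleteCE A :=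
  ⟨hA, fun _ hC => hC.turingLE_haltingSet.trans hK⟩

lemma IsTuringCompleteCE.not_isComputable {A : Set ℕ} (hA : IsTuringCompleteCE A) :
    ¬ IsComputable A :=
  fun h => not_isComputable_haltingSet ((hA.2 _ isCE_haltingSet).isComputable h)

end Halting

section Markers

/-- The position of marker `j` after the moves recorded in a list of cuts, most recent first.
Initially marker `j` is at `j`. A cut `c` that follows `n` others moves each marker `j ≥ c` to the
position of marker `j + 2 * (n + 1)`, which has the same parity and lies beyond `n`. -/
def marker : List ℕ → ℕ → ℕ
  | [], j => j
  | c :: H, j => marker H (if j < c then j else j + 2 * (H.length + 1))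

variable {H : List ℕ} {c j : ℕ}

lemma marker_cons_of_lt (h : j < c) : marker (c :: H) j = marker H j := by
  rw [marker, if_pos h]

lemma marker_cons_of_le (h : c ≤ j) :
    marker (c :: H) j = marker H (j + 2 * (H.length + 1)) := by
  rw [marker, if_neg h.not_gt]

lemma marker_strictMono (H : List ℕ) : StrictMono (marker H) := by
  induction H with
  | nil => exact strictMono_id
  | cons c H ih =>
    intro i j hij
    simp only [marker]
    exact ih (by split_ifs <;> omega)

lemma marker_le_marker_cons (H : List ℕ) (c j : ℕ) : marker H j ≤ marker (c :: H) j :=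
  (marker_strictMono H).monotone (by split_ifs <;> omega)

lemma length_lt_marker_cons_self (H : List ℕ) (c : ℕ) : H.length < marker (c :: H) c := by
  rw [marker_cons_of_le le_rfl]
  have := (marker_strictMono H).le_apply (x := c + 2 * (H.length + 1))
  omega

lemma exists_marker_eq_marker_cons (H : List ℕ) (c j : ℕ) :
    ∃ j', j' % 2 = j % 2 ∧ marker H j' = marker (c :: H) j :=
  ⟨_, by split_ifs <;> omega, rfl⟩

lemma marker_cons_ne_marker (hc : c ≤ j) (hj : j ≤ H.length) (k : ℕ) :
    marker (c :: H) k ≠ marker H j :=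
  (marker_strictMono H).injective.ne (by split_ifs <;> omega)

/-- The recursion defining `marker` changes its parameter `j`, which the recursors for `Primrec` do
not allow; a fold does. -/
lemma marker_eq_foldl (H : List ℕ) (j : ℕ) :
    marker H j = (H.foldl
      (fun p c => (if p.1 < c then p.1 else p.1 + 2 * p.2, p.2 - 1)) (j, H.length)).1 := by
  induction H generalizing j with
  | nil => rfl
  | cons c H ih => rw [marker, ih, List.foldl_cons, List.length_cons, Nat.add_sub_cancel]

open Primrec in
lemma primrec_marker : Primrec₂ marker := by
  have hc : Primrec fun q : (List ℕ × ℕ) × ((ℕ × ℕ) × ℕ) => q.2.2 := snd.comp snd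
  have hj : Primrec fun q : (List ℕ × ℕ) × ((ℕ × ℕ) × ℕ) => q.2.1.1 :=
    fst.comp (fst.comp snd)
  have hn : Primrec fun q : (List ℕ × ℕ) × ((ℕ × ℕ) × ℕ) => q.2.1.2 :=
    snd.comp (fst.comp snd)
  have hstep := (ite (nat_lt.comp hj hc) hj (nat_add.comp hj (nat_mul.comp (const 2) hn))).pair
    (nat_sub.comp hn (const 1))
  exact (fst.comp (list_foldl fst (snd.pair (list_length.comp fst)) hstep.to₂)).of_eq
    fun p => (marker_eq_foldl p.1 p.2).symm

end Markers

section Unmarked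

/-- The set of those numbers that are not the position of a marker with the same parity as `i`,
when marker `j` is at position `μ j`. -/
def unmarked (μ : ℕ → ℕ) (i : ℕ) : Set ℕ := {x | ∀ j, j % 2 = i % 2 → μ j ≠ x}

/-- The set `unmarked μ i` together with the positions of all markers from the `c`-th on. -/
def unmarkedBelow (μ : ℕ → ℕ) (i c : ℕ) : Set ℕ := {x | ∀ j < c, j % 2 = i % 2 → μ j ≠ x}

variable {μ ν : ℕ → ℕ} {i c : ℕ}

lemma mem_unmarked_iff_mem_unmarkedBelow (hμ : StrictMono μ) {x : ℕ} (hx : x < μ c) :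
    x ∈ unmarked μ i ↔ x ∈ unmarkedBelow μ i c := by
  refine ⟨fun h j _ => h j, fun h j hj hjx => h j ?_ hj hjx⟩
  rwa [← hμ.lt_iff_lt, hjx]

lemma accepts_unmarked_iff (hμ : StrictMono μ) {T : Table} (hT : T.1 ≤ μ c) :
    T.Accepts (unmarked μ i) ↔ T.Accepts (unmarkedBelow μ i c) :=
  Table.accepts_congr fun _ hx => mem_unmarked_iff_mem_unmarkedBelow hμ (hx.trans_le hT)

lemma unmarkedBelow_congr (h : ∀ j < c, μ j = ν j) :
    unmarkedBelow μ i c = unmarkedBelow ν i c :=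
  Set.ext fun _ => forall₂_congr fun j hj => by rw [h j hj]

lemma unmarkedBelow_succ (hc : c % 2 ≠ i % 2) :
    unmarkedBelow μ i (c + 1) = unmarkedBelow μ i c := by
  refine Set.ext fun x => ⟨fun h j hj => h j (by omega), fun h j hj hi => h j ?_ hi⟩
  exact (Nat.lt_succ_iff.1 hj).lt_of_ne fun hjc => hc (hjc ▸ hi)

open Primrec in
lemma primrecRel_mem_unmarkedBelow {α : Type*} [Primcodable α] {μ : α → ℕ → ℕ} {c : α → ℕ}
    (hμ : Primrec₂ μ) (hc : Primrec c) (i : ℕ) :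
    PrimrecRel fun a x => x ∈ unmarkedBelow (μ a) i (c a) := by
  have hpar : PrimrecRel fun (_ : α × ℕ) j => j % 2 = i % 2 :=
    Primrec.eq.comp (nat_mod.comp snd (const 2)) (const (i % 2))
  have hpos : PrimrecRel fun (p : α × ℕ) j => μ p.1 j = p.2 :=
    Primrec.eq.comp (hμ.comp (fst.comp fst) snd) (snd.comp fst)
  have hne : PrimrecRel fun (p : α × ℕ) j => ¬ j % 2 = i % 2 ∨ ¬ μ p.1 j = p.2 :=
    hpar.not.or hpos.not
  refine (primrecPred_forall_lt (hc.comp fst) hne).of_eq fun p => ?_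
  simp only [unmarkedBelow, Set.mem_ofPred_eq, imp_iff_not_or, ne_eq]

/-- The set is cofinite. -/
lemma isComputable_unmarkedBelow (μ : ℕ → ℕ) (i c : ℕ) : IsComputable (unmarkedBelow μ i c) := by
  let L := ((List.range c).filter (· % 2 = i % 2)).map μ
  have hL : PrimrecPred fun x => x ∉ L := (primrecRel_mem_list.comp .id (.const L)).not
  refine hL.computablePred.of_eq fun x => ?_
  simp [L, unmarkedBelow]

end Unmarked

section Construction

/-- The history of the first `s` cuts when each cut is determined by the previous ones according to
the strategy `ρ`. -/
def history (ρ : List ℕ → ℕ) : ℕ → List ℕ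
  | 0 => []
  | s + 1 => ρ (history ρ s) :: history ρ s

/-- The set enumerated by the strategy `ρ` for the parity of `i`. If all markers come to rest, its
complement consists of the final positions of those with this parity. -/
def limitSet (ρ : List ℕ → ℕ) (i : ℕ) : Set ℕ := ⋃ s, unmarked (marker (history ρ s)) i

/-- Under the strategy `ρ`, each marker `j` comes to rest at the position `μ j`. -/
def MarkersConverge (ρ : List ℕ → ℕ) (μ : ℕ → ℕ) : Prop :=
  ∀ j, ∀ᶠ s in atTop, marker (history ρ s) j = μ j

variable {ρ : List ℕ → ℕ} {μ : ℕ → ℕ} {i j s t : ℕ}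

@[simp] lemma length_history (ρ : List ℕ → ℕ) (s : ℕ) : (history ρ s).length = s := by
  induction s with
  | zero => rfl
  | succ s ih => rw [history, List.length_cons, ih]

lemma primrec_history (hρ : Primrec ρ) : Primrec (history ρ) := by
  have h : Primrec fun s : ℕ => (s.rec [] fun _ H => ρ H :: H : List ℕ) :=
    Primrec.nat_rec₁ [] (Primrec.list_cons.comp (hρ.comp Primrec.snd) Primrec.snd)
  refine h.of_eq fun s => ?_
  induction s with
  | zero => rfl
  | succ s ih => simp only [history, ih]

lemma monotone_unmarked_marker_history (ρ : List ℕ → ℕ) (i : ℕ) :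
    Monotone fun s => unmarked (marker (history ρ s)) i := by
  refine monotone_nat_of_le_succ fun s x hx j hj => ?_
  obtain ⟨j', hj', h⟩ := exists_marker_eq_marker_cons (history ρ s) (ρ (history ρ s)) j
  exact h ▸ hx j' (hj'.trans hj)

lemma isCE_limitSet (hρ : Primrec ρ) (i : ℕ) : IsCE (limitSet ρ i) := by
  have hmarker : Primrec₂ fun (p : ℕ × ℕ) j => marker (history ρ p.2) j :=
    primrec_marker.comp ((primrec_history hρ).comp (Primrec.snd.comp Primrec.fst)) Primrec.snd
  have hstage : PrimrecRel fun x s => x ∈ unmarkedBelow (marker (history ρ s)) i (x + 1) :=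
    (primrecRel_mem_unmarkedBelow hmarker (Primrec.succ.comp Primrec.fst) i).comp
      Primrec.id Primrec.fst
  refine (isCE_of_primrecRel hstage).of_eq fun x => ?_
  have hx (s : ℕ) : x < marker (history ρ s) (x + 1) :=
    x.lt_succ_self.trans_le (marker_strictMono _).le_apply
  simp [limitSet, mem_unmarked_iff_mem_unmarkedBelow (marker_strictMono _) (hx _)]

lemma marker_mem_limitSet (hj : ρ (history ρ s) ≤ j) (hjs : j ≤ s) :
    marker (history ρ s) j ∈ limitSet ρ i :=
  Set.mem_iUnion.2 ⟨s + 1, fun k _ => marker_cons_ne_marker hj (by simpa using hjs) k⟩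

lemma marker_history_eq (h : ∀ t ≥ s, j < ρ (history ρ t)) (hst : s ≤ t) :
    marker (history ρ t) j = marker (history ρ s) j := by
  induction t, hst using Nat.le_induction with
  | base => rfl
  | succ t hst ih => rw [history, marker_cons_of_lt (h t hst), ih]

/-- A later move would enumerate the position of the marker. -/
lemma lt_cut_of_marker_notMem (hjs : j ≤ s) (hmem : marker (history ρ s) j ∉ limitSet ρ i)
    (hst : s ≤ t) : j < ρ (history ρ t) := by
  suffices h : marker (history ρ t) j = marker (history ρ s) j by
    by_contra hj
    exact hmem (h ▸ marker_mem_limitSet (not_lt.1 hj) (hjs.trans hst))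
  induction t, hst using Nat.le_induction with
  | base => rfl
  | succ t hst ih =>
    rw [history, marker_cons_of_lt, ih]
    by_contra hj
    exact hmem (ih ▸ marker_mem_limitSet (not_lt.1 hj) (hjs.trans hst))

lemma exists_markersConverge (hρ : Tendsto (fun s => ρ (history ρ s)) atTop atTop) :
    ∃ μ, MarkersConverge ρ μ := by
  choose S hS using fun j => eventually_atTop.1 (hρ.eventually_gt_atTop j)
  exact ⟨fun j => marker (history ρ (S j)) j, fun j =>
    eventually_atTop.2 ⟨S j, fun t ht => marker_history_eq (hS j) ht⟩⟩

namespace MarkersConverge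

lemma eventually_forall_lt (hμ : MarkersConverge ρ μ) (c : ℕ) :
    ∀ᶠ s in atTop, ∀ j < c, marker (history ρ s) j = μ j :=
  (eventually_all_finite (Set.finite_Iio c)).2 fun j _ => hμ j

lemma strictMono (hμ : MarkersConverge ρ μ) : StrictMono μ := fun i j hij => by
  obtain ⟨s, hi, hj⟩ := ((hμ i).and (hμ j)).exists
  exact hi ▸ hj ▸ marker_strictMono _ hij

lemma limitSet_eq_unmarked (hμ : MarkersConverge ρ μ) (i : ℕ) : limitSet ρ i = unmarked μ i := by
  refine Set.ext fun x => Set.mem_iUnion.trans ⟨fun ⟨s, hs⟩ j hj => ?_, fun hx => ?_⟩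
  · obtain ⟨t, hst, ht⟩ := ((eventually_ge_atTop s).and (hμ j)).exists
    exact ht ▸ monotone_unmarked_marker_history ρ i hst hs j hj
  · obtain ⟨s, hs⟩ := (hμ.eventually_forall_lt (x + 1)).exists
    have hlt {ν : ℕ → ℕ} (hν : StrictMono ν) : x < ν (x + 1) :=
      x.lt_succ_self.trans_le hν.le_apply
    rw [mem_unmarked_iff_mem_unmarkedBelow hμ.strictMono (hlt hμ.strictMono),
      ← unmarkedBelow_congr hs] at hx
    exact ⟨s, (mem_unmarked_iff_mem_unmarkedBelow (marker_strictMono _)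
      (hlt (marker_strictMono _))).2 hx⟩

end MarkersConverge

lemma stage_of_marker_notMem {P : ℕ → Prop}
    (hcode : ∀ s, ¬ P s → P (s + 1) → ρ (history ρ s) ≤ j) (hjs : j ≤ s)
    (hmem : marker (history ρ s) j ∉ limitSet ρ i) (hst : s ≤ t) (ht : P t) : P s := by
  induction t, hst using Nat.le_induction with
  | base => exact ht
  | succ t hst ih =>
    by_contra hs
    exact (lt_cut_of_marker_notMem hjs hmem hst).not_ge (hcode t (mt ih hs) ht)

/-- By the time marker `2 * k + i` is found outside `limitSet ρ i`, it is at rest, hence the stage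
at which `k` is enumerated has passed if there is one. -/
lemma turingLE_limitSet (hρ : Primrec ρ) (hcut : Tendsto (fun s => ρ (history ρ s)) atTop atTop)
    {E : ℕ → ℕ → Prop} (hE : PrimrecRel E) (hmono : Monotone E)
    (hcode : ∀ s k, ¬ E s k → E (s + 1) k → ρ (history ρ s) ≤ k) (i : ℕ) :
    TuringLE {k | ∃ s, E s k} (limitSet ρ i) := by
  have hindex : Primrec fun p : ℕ × ℕ => 2 * p.1 + i :=
    Primrec.nat_add.comp (Primrec.nat_mul.comp (Primrec.const 2) Primrec.fst) (Primrec.const i)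
  have hstage : Primrec fun p : ℕ × ℕ => p.2 + (2 * p.1 + i) :=
    Primrec.nat_add.comp Primrec.snd hindex
  refine turingLE_of_search (q := fun k s => marker (history ρ (s + (2 * k + i))) (2 * k + i))
    (D := fun k s => E (s + (2 * k + i)) k)
    (primrec_marker.comp ((primrec_history hρ).comp hstage) hindex).to_comp
    (hE.comp hstage Primrec.fst).computablePred (fun k => ?_) fun k s hs => ?_
  · obtain ⟨μ, hμ⟩ := exists_markersConverge hcut
    obtain ⟨s, hs⟩ := ((tendsto_add_atTop_nat (2 * k + i)).eventually (hμ (2 * k + i))).exists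
    refine ⟨s, fun hmem => ?_⟩
    rw [hs, hμ.limitSet_eq_unmarked] at hmem
    exact hmem (2 * k + i) (by omega) rfl
  · refine ⟨fun ⟨t, ht⟩ => ?_, fun h => ⟨_, h⟩⟩
    have hcode' : ∀ s, ¬ E s k → E (s + 1) k → ρ (history ρ s) ≤ 2 * k + i :=
      fun s h h' => (hcode s k h h').trans (by omega)
    exact stage_of_marker_notMem (P := (E · k)) hcode' (Nat.le_add_left _ _) hs (le_max_right t _)
      (hmono (le_max_left _ _) k ht)

end Construction

section Strategy

/-- The truth tables in the pair `T` have the same output on the approximations to the two sets in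
which all markers from the `c`-th on have been enumerated. -/
def Agree (μ : ℕ → ℕ) (c : ℕ) (T : Table × Table) : Prop :=
  T.1.Accepts (unmarkedBelow μ 0 c) ↔ T.2.Accepts (unmarkedBelow μ 1 c)

/-- Within `H.length` steps, the `e`-th pair of truth table reductions is seen to disagree on some
argument with both uses at most `b`, if all markers from the `c`-th on are enumerated. -/
def Disagree (H : List ℕ) (c b e : ℕ) : Prop :=
  ∃ m < H.length, ∃ T ∈ output (Table × Table) e H.length m,
    T.1.1 ≤ b ∧ T.2.1 ≤ b ∧ ¬ Agree (marker H) c T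

/-- Marker `c` wants to be moved: the `c`-th computation has just halted, or the move makes a pair
of reductions disagree that does not yet disagree on the part of the sets below marker `c`. -/
def Attention (H : List ℕ) (c : ℕ) : Prop :=
  (¬ HaltsBy H.length c ∧ HaltsBy (H.length + 1) c) ∨
    ∃ e < c + 1, Disagree H c H.length e ∧ ¬ Disagree H c (marker H c) e

open Classical in
/-- The strategy of the construction: to cut at the first marker that wants to be moved. -/
noncomputable def nextCut (H : List ℕ) : ℕ :=
  (List.range H.length).findIdx fun c => decide (Attention H c)

section Primrec

open Primrec

variable {α : Type*} [Primcodable α]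

lemma primrecPred_agree {μ : α → ℕ → ℕ} {c : α → ℕ} {T : α → Table × Table} (hμ : Primrec₂ μ)
    (hc : Primrec c) (hT : Primrec T) : PrimrecPred fun a => Agree (μ a) (c a) (T a) :=
  primrecPred_iff
    (primrecPred_accepts (primrecRel_mem_unmarkedBelow hμ hc 0) (fst.comp hT))
    (primrecPred_accepts (primrecRel_mem_unmarkedBelow hμ hc 1) (snd.comp hT))

lemma primrecPred_disagree {H : α → List ℕ} {c b e : α → ℕ} (hH : Primrec H) (hc : Primrec c)
    (hb : Primrec b) (he : Primrec e) : PrimrecPred fun a => Disagree (H a) (c a) (b a) (e a) := by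
  have hlen : Primrec fun a => (H a).length := list_length.comp hH
  refine primrecPred_exists_lt hlen ?_
  refine primrecPred_exists_mem_option
    (primrec_output.comp (((he.comp fst).pair (hlen.comp fst)).pair snd)) ?_
  have hb' : Primrec fun p : (α × ℕ) × (Table × Table) => b p.1.1 := hb.comp (fst.comp fst)
  have hμ : Primrec₂ fun (p : (α × ℕ) × (Table × Table)) j => marker (H p.1.1) j :=
    primrec_marker.comp (hH.comp (fst.comp (fst.comp fst))) snd
  have hu₁ := nat_le.comp (fst.comp (fst.comp snd)) hb'
  have hu₂ := nat_le.comp (fst.comp (snd.comp snd)) hb'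
  exact hu₁.and (hu₂.and (primrecPred_agree hμ (hc.comp (fst.comp fst)) snd).not)

lemma primrecRel_attention : PrimrecRel Attention := by
  have hlen : Primrec fun p : List ℕ × ℕ => p.1.length := list_length.comp fst
  have hpos : Primrec fun q : (List ℕ × ℕ) × ℕ => marker q.1.1 q.1.2 :=
    primrec_marker.comp (fst.comp fst) (snd.comp fst)
  have hhalt := (primrecRel_haltsBy.comp hlen snd).not.and
    (primrecRel_haltsBy.comp (succ.comp hlen) snd)
  have hdis := (primrecPred_disagree (fst.comp fst) (snd.comp fst) (hlen.comp fst) snd).and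
    (primrecPred_disagree (fst.comp fst) (snd.comp fst) hpos snd).not
  exact hhalt.or (primrecPred_exists_lt (succ.comp snd) hdis)

lemma primrec_nextCut : Primrec nextCut := by
  classical
  exact list_findIdx (list_range.comp list_length) primrecRel_attention.decide

end Primrec

variable {H : List ℕ} {c : ℕ}

lemma attention_nextCut (h : nextCut H < H.length) : Attention H (nextCut H) := by
  classical
  have hlt : (List.range H.length).findIdx (fun c => decide (Attention H c)) <
      (List.range H.length).length := by rwa [List.length_range]
  simpa only [nextCut, List.getElem_range, decide_eq_true_eq] using
    List.findIdx_getElem (w := hlt)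

lemma nextCut_le_of_attention (h : Attention H c) : nextCut H ≤ c := by
  classical
  by_contra hlt
  simpa [h] using List.not_of_lt_findIdx (not_le.1 hlt)

lemma Disagree.cons {b c' b' e : ℕ} (h : Disagree H c b e) (hc : c ≤ c') (hb : b ≤ b') :
    Disagree (c' :: H) c b' e := by
  obtain ⟨m, hm, T, hT, h₁, h₂, hne⟩ := h
  have hlen : H.length ≤ (c' :: H).length := by simp
  have hmarker : ∀ j < c, marker (c' :: H) j = marker H j :=
    fun j hj => marker_cons_of_lt (hj.trans_le hc)
  refine ⟨m, hm.trans_le hlen, T, output_mono hlen hT, h₁.trans hb, h₂.trans hb, ?_⟩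
  rwa [Agree, unmarkedBelow_congr hmarker, unmarkedBelow_congr hmarker]

lemma eventually_of_succ {P : ℕ → Prop} (h : ∀ᶠ s in atTop, P s → P (s + 1)) :
    ∀ᶠ s in atTop, P (s + 1) → P s := by
  obtain ⟨S, hS⟩ := eventually_atTop.1 h
  by_cases hP : ∃ s ≥ S, P s
  · obtain ⟨s, hs, hPs⟩ := hP
    have hPt : ∀ t ≥ s, P t := fun t ht =>
      Nat.le_induction hPs (fun t ht => hS t (hs.trans ht)) t ht
    exact eventually_atTop.2 ⟨s, fun t ht _ => hPt t ht⟩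
  · push Not at hP
    exact eventually_atTop.2 ⟨S, fun t ht h => (hP _ (ht.trans t.le_succ) h).elim⟩

/-- While the markers before the `c`-th rest, a disagreement that a move of marker `c` has brought
about persists, and lies below the new position of marker `c`. -/
lemma tendsto_nextCut : Tendsto (fun s => nextCut (history nextCut s)) atTop atTop := by
  refine tendsto_atTop.2 fun c => ?_
  induction c with
  | zero => exact Eventually.of_forall fun s => Nat.zero_le _
  | succ c ih =>
    let P (e s : ℕ) : Prop :=
      Disagree (history nextCut s) c (marker (history nextCut s) c) e
    have hP : ∀ᶠ s in atTop, ∀ e < c + 1, P e (s + 1) → P e s := by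
      refine (eventually_all_finite (Set.finite_Iio (c + 1))).2 fun e _ => eventually_of_succ ?_
      filter_upwards [ih] with s hs h
      exact h.cons hs (marker_le_marker_cons _ _ _)
    have hhalt : ∀ᶠ s in atTop, HaltsBy (s + 1) c → HaltsBy s c :=
      eventually_of_succ (Eventually.of_forall fun s => haltsBy_mono s.le_succ c)
    filter_upwards [ih, hP, hhalt, eventually_gt_atTop c] with s hs hP hhalt hcs
    refine Nat.succ_le_of_lt (hs.lt_of_ne fun hc => ?_)
    have hlt : nextCut (history nextCut s) < (history nextCut s).length := by
      rwa [← hc, length_history]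
    rcases hc ▸ attention_nextCut hlt with ⟨h₁, h₂⟩ | ⟨e, he, h₁, h₂⟩
    · rw [length_history] at h₁ h₂
      exact h₁ (hhalt h₂)
    · refine h₂ (hP e he ?_)
      simp only [P, history, ← hc]
      exact h₁.cons le_rfl (length_lt_marker_cons_self _ _).le

end Strategy

section Verification

lemma isTuringCompleteCE_limitSet (i : ℕ) : IsTuringCompleteCE (limitSet nextCut i) := by
  refine isTuringCompleteCE_of_haltingSet_turingLE (isCE_limitSet primrec_nextCut i) ?_
  have hcode : ∀ s k, ¬ HaltsBy s k → HaltsBy (s + 1) k → nextCut (history nextCut s) ≤ k :=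
    fun s k h₁ h₂ => nextCut_le_of_attention (.inl (by simpa using ⟨h₁, h₂⟩))
  have hK : haltingSet = {k | ∃ s, HaltsBy s k} := Set.ext fun _ => mem_haltingSet_iff
  exact hK ▸ turingLE_limitSet primrec_nextCut tendsto_nextCut primrecRel_haltsBy haltsBy_mono
    hcode i

lemma agree_iff_of_use_le {μ : ℕ → ℕ} {c : ℕ} {T : Table × Table} (hμ : StrictMono μ)
    (h₁ : T.1.1 ≤ μ c) (h₂ : T.2.1 ≤ μ c) :
    Agree μ c T ↔ (T.1.Accepts (unmarked μ 0) ↔ T.2.Accepts (unmarked μ 1)) := by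
  rw [Agree, accepts_unmarked_iff hμ h₁, accepts_unmarked_iff hμ h₂]

lemma agree_congr {μ ν : ℕ → ℕ} {c : ℕ} {T : Table × Table} (h : ∀ j < c, μ j = ν j) :
    Agree μ c T ↔ Agree ν c T := by
  rw [Agree, unmarkedBelow_congr h, unmarkedBelow_congr h, Agree]

/-- Otherwise marker `c` would want to be moved at every late stage. -/
lemma agree_of_computes {μ : ℕ → ℕ} {T : ℕ → Table × Table} {e c : ℕ}
    (hμ : MarkersConverge nextCut μ) (he : Computes e T)
    (hT : ∀ m, (T m).1.Accepts (unmarked μ 0) ↔ (T m).2.Accepts (unmarked μ 1))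
    (hec : e ≤ c) (m : ℕ) : Agree μ c (T m) := by
  by_contra hne
  obtain ⟨s, hmarker, hcut, hout, hm, h₁, h₂⟩ := ((hμ.eventually_forall_lt (c + 1)).and
    ((tendsto_nextCut.eventually_gt_atTop c).and ((he.eventually_mem_output m).and
    ((eventually_gt_atTop m).and ((eventually_ge_atTop (T m).1.1).and
    (eventually_ge_atTop (T m).2.1)))))).exists
  have hagree (m : ℕ) : Agree (marker (history nextCut s)) c (T m) ↔ Agree μ c (T m) :=
    agree_congr fun j hj => hmarker j (hj.trans c.lt_succ_self)
  refine hcut.not_ge (nextCut_le_of_attention (.inr ⟨e, Nat.lt_succ_of_le hec, ?_, ?_⟩))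
  · simp only [Disagree, length_history]
    exact ⟨m, hm, T m, hout, h₁, h₂, (hagree m).not.2 hne⟩
  · rintro ⟨m', -, U, hU, hU₁, hU₂, hne'⟩
    obtain rfl := he.eq_of_mem_output hU
    rw [hmarker c c.lt_succ_self] at hU₁ hU₂
    exact hne' ((hagree m').2 ((agree_iff_of_use_le hμ.strictMono hU₁ hU₂).2 (hT m')))

/-- Only one of the two sets changes from `c` to `c + 1`. So the output on the other one is
unchanged, and by agreement this holds for both outputs. -/
lemma accepts_unmarkedBelow_iff {μ : ℕ → ℕ} {T : Table × Table} {e c : ℕ}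
    (h : ∀ c ≥ e, Agree μ c T) (hc : e ≤ c) :
    T.1.Accepts (unmarkedBelow μ 0 c) ↔ T.1.Accepts (unmarkedBelow μ 0 e) := by
  simp only [Agree] at h
  induction c, hc using Nat.le_induction with
  | base => rfl
  | succ c hc ih =>
    rw [← ih]
    rcases Nat.mod_two_eq_zero_or_one c with hpar | hpar
    · rw [h (c + 1) (hc.trans c.le_succ), h c hc, unmarkedBelow_succ (by omega)]
    · rw [unmarkedBelow_succ (by omega)]

lemma isComputable_of_ttle {B : Set ℕ} (h₀ : TTLE B (limitSet nextCut 0))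
    (h₁ : TTLE B (limitSet nextCut 1)) : IsComputable B := by
  obtain ⟨μ, hμ⟩ := exists_markersConverge tendsto_nextCut
  rw [hμ.limitSet_eq_unmarked, ttle_iff] at h₀ h₁
  obtain ⟨T₀, hT₀, hB₀⟩ := h₀
  obtain ⟨T₁, hT₁, hB₁⟩ := h₁
  obtain ⟨e, he⟩ := exists_computes (hT₀.pair hT₁)
  have hagree (m c : ℕ) (hc : c ≥ e) : Agree μ c (T₀ m, T₁ m) :=
    agree_of_computes hμ he (fun m => (hB₀ m).symm.trans (hB₁ m)) hc m
  refine (ttle_iff.2 ⟨T₀, hT₀, fun m => ?_⟩ : TTLE B (unmarkedBelow μ 0 e)).isComputable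
    (isComputable_unmarkedBelow μ 0 e)
  have huse : (T₀ m).1 ≤ μ (max e (T₀ m).1) := (le_max_right _ _).trans hμ.strictMono.le_apply
  rw [hB₀ m, accepts_unmarked_iff hμ.strictMono huse]
  exact accepts_unmarkedBelow_iff (hagree m) (le_max_left _ _)

end Verification

end TTMinimalPair

theorem mainTheorem4 :
    ∃ A₁ A₂ : Set ℕ,
      TTMinimalPair.IsTuringCompleteCE A₁ ∧ TTMinimalPair.IsTuringCompleteCE A₂ ∧
        TTMinimalPair.IsTTMinimalPair A₁ A₂ := by
  have h₀ := TTMinimalPair.isTuringCompleteCE_limitSet 0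
  have h₁ := TTMinimalPair.isTuringCompleteCE_limitSet 1
  exact ⟨_, _, h₀, h₁, h₀.not_isComputable, h₁.not_isComputable,
    fun _ => TTMinimalPair.isComputable_of_ttle⟩
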